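/- **Theorem.** Let $n\ge 1$, let $Q\in\mathbb R^{n\times n}$ be symmetric positive definite, let $Z\subseteq\{0,1\}^n$ and $$X_{Q,Z}=\{(x,z,x_0)\in\mathbb R^n\times\{0,1\}^n\times\mathbb R:\ x_0\ge x^\top Qx,\ x_i(1-z_i)=0\ (i=1,\dots,n),\ z\in Z\}.$$ Let $Z$ be described by a dynamic program with an initial state $\sigma^1$ and partial transition functions $\psi_\ell(\sigma,b)$ ($\ell=1,\dots,n$, $b\in\{0,1\}$), an undefined value meaning infeasibility: $z\in Z$ iff the transitions with decisions $z_1,\dots,z_n$, started at $\sigma^1$, are all defined. (For $Z=\{0,1\}^n$ one state suffices.) *Compressed decision diagram.* Let $Q_\ell$ be the $\ell$-th column of $Q$, $e_\ell$ the $\ell$-th unit vector and $\pi_j=\max\{i: Q_{ji}\ne0\}$. For $W\in\mathbb R^{n\times n}$ let $$u^\ell(W)=\frac{-WQ_\ell+e_\ell}{\sqrt{Q_{\ell\ell}-Q_\ell^\top WQ_\ell}},\qquad \phi_\ell(W,b)_{ij}=\begin{cases}0&\ell\ge\pi_j,\\ W_{ij}&\ell<\pi_j,\ b=0,\\ W_{ij}+u^\ell(W)_iu^\ell(W)_j&\ell<\pi_j,\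 b=1.\end{cases}$$ The nodes of layer $1,\dots,n+1$ are the pairs (matrix, state) defined recursively: layer $1$ consists of $(0_{n\times n},\sigma^1)$, and layer $\ell+1$ of all $(\phi_\ell(W,b),\psi_\ell(\sigma,b))$ with $(W,\sigma)$ in layer $\ell$, $b\in\{0,1\}$ and $\psi_\ell(\sigma,b)$ defined; equal pairs in the same layer are one node. $N$ is the (finite) set of all nodes. Each such choice of $(W,\sigma)$ in layer $\ell$ and of $b$ gives one arc $a$ with tail $t_a$ the node $(W,\sigma)$ of layer $\ell$, head $h_a$ the node $(\phi_\ell(W,b),\psi_\ell(\sigma,b))$ of layer $\ell+1$, layer $\ell(a)=\ell$, value $\nu_a=b$, and vector $u_a=u^\ell(W)$ if $b=1$, $u_a=0$ if $b=0$. $A$ is the (finite) set of arcs, and $\ell(v)$ denotes the layer of a node $v$. With the conventions $0/0=0$ and $c/0=+\infty$ for $c>0$, the following hold. 1. A point $(x,z,x_0)\in\mathbb R^n\times\mathbb R^n\times\mathbb R$ lies in $\operatorname{conv}(X_{Q,Z})$ if and only if there exist $r,w\in\mathbb R^A$ with $$\begin{aligned}&x_0\ge\sum_{a\in A}\frac{w_a^2}{r_a},\qquad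 x=\sum_{a\in A}u_aw_a,\qquad z=\sum_{a\in A:\,\nu_a=1}e_{\ell(a)}r_a,\\ &\sum_{a:\,h_a=v}r_a=\sum_{a:\,t_a=v}r_a\quad\text{for all nodes }v\text{ with }2\le\ell(v)\le n,\\ &\sum_{a:\,\ell(a)=1}r_a=1,\qquad\sum_{a:\,\ell(a)=n}r_a=1,\qquad r\ge0.\end{aligned}\tag{$*$}$$ 2. $\operatorname{conv}(X_{Q,Z})$ is closed, so the same system describes $\operatorname{cl}\operatorname{conv}(X_{Q,Z})$. 3. The system is SOCP-representable with size linear in $|A|$: there is a finite system of affine equations, affine inequalities and second-order cone constraints $\|(f_1,\dots,f_d)\|_2\le g$ ($f_i,g$ affine) in $x,z,x_0$ and the $3|A|$ additional variables $r,w,s\in\mathbb R^A$ such that $(x,z,x_0,r,w)$ satisfies $(*)$ if and only if $(x,z,x_0,r,w,s)$ satisfies that system for some $s\in\mathbb R^A$. Counting one row for each equation and inequality and $d+1$ rows for each cone constraint, it has at most $4|A|+2n+3$ rows, and at most $9|A|$ rows if $Z\ne\emptyset$. -/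

import Mathlib

namespace MIQO

open scoped Matrix

/-! ### The mixed-integer set -/

/-- The set `X_{Q,Z}` of all `(x, z, x₀)` with `z` binary, `x₀ ≥ xᵀQx`, `x ∘ (1 - z) = 0`, `z ∈ Z`. -/
def mixedSet {n : ℕ} (Q : Matrix (Fin n) (Fin n) ℝ) (Z : Set (Fin n → ℝ)) :
    Set ((Fin n → ℝ) × (Fin n → ℝ) × ℝ) :=
  {p | (∀ i, p.2.1 i = 0 ∨ p.2.1 i = 1) ∧ p.1 ⬝ᵥ (Q *ᵥ p.1) ≤ p.2.2 ∧
    (∀ i, p.1 i * (1 - p.2.1 i) = 0) ∧ p.2.1 ∈ Z}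

/-! ### Dynamic programs describing the binary constraints -/

/-- A dynamic program with `n` stages: at stage `i`, from state `s`, the decision `b` leads to
the state `s'` if `step i s b = some s'`, and is infeasible if `step i s b = none`. -/
structure DynProg (n : ℕ) (S : Type*) where
  init : S
  step : Fin n → S → Bool → Option S

/-- The sequence of decisions `b` can be carried out from the initial state without ever meeting
an infeasible transition. -/
def DynProg.Accepts {n : ℕ} {S : Type*} (P : DynProg n S) (b : Fin n → Bool) : Prop :=
  ∃ σ : Fin (n + 1) → S, σ 0 = P.init ∧ ∀ i : Fin n, P.step i (σ i.castSucc) (b i) = some (σ i.succ)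

/-- The 0/1 vector of a sequence of decisions. -/
def bitVec {n : ℕ} (b : Fin n → Bool) : Fin n → ℝ := fun i => if b i = true then 1 else 0

/-- `Z` is exactly the set of 0/1 vectors accepted by the dynamic program
(in particular `Z ⊆ {0,1}ⁿ`). -/
def DynProg.Represents {n : ℕ} {S : Type*} (P : DynProg n S) (Z : Set (Fin n → ℝ)) : Prop :=
  Z = bitVec '' {b | P.Accepts b}

/-! ### The compressed decision diagram -/

open Classical in
/-- The relevant index `π_i = max {j | Q_ij ≠ 0}` (it is `⊥` only if row `i` of `Q` vanishes). -/
noncomputable def relevantIndex {n : ℕ} (Q : Matrix (Fin n) (Fin n) ℝ) (i : Fin n) :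
    WithBot (Fin n) :=
  (Finset.univ.filter fun j => Q i j ≠ 0).max

/-- `u = (Q_ℓℓ - Q_ℓᵀ W Q_ℓ)^(-1/2) (-W Q_ℓ + e_ℓ)`, where `Q_ℓ` is the `ℓ`-th column of `Q`. -/
noncomputable def transitionVector {n : ℕ} (Q : Matrix (Fin n) (Fin n) ℝ) (l : Fin n)
    (W : Matrix (Fin n) (Fin n) ℝ) : Fin n → ℝ :=
  (1 / Real.sqrt (Q l l - (fun i => Q i l) ⬝ᵥ (W *ᵥ fun i => Q i l))) •
    (-(W *ᵥ fun i => Q i l) + Pi.single l 1)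

open Classical in
/-- The matrix stored after decision `b` at stage `l`: columns that are no longer relevant are set
to zero, the others are kept if `b = 0` and receive the update `u uᵀ` if `b = 1`. -/
noncomputable def nextMatrix {n : ℕ} (Q : Matrix (Fin n) (Fin n) ℝ) (l : Fin n)
    (W : Matrix (Fin n) (Fin n) ℝ) (b : Bool) : Matrix (Fin n) (Fin n) ℝ :=
  Matrix.of fun i j =>
    if relevantIndex Q j ≤ (l : WithBot (Fin n)) then 0
    else if b = true then W i j + transitionVector Q l W i * transitionVector Q l W j
    else W i j

/-- `Reachable Q P l W s`: the state consisting of the matrix `W` and of the state `s` of the dynamic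
program occurs in layer `l`. Layers are numbered from `0` to `n`. -/
inductive Reachable {n : ℕ} {S : Type*} (Q : Matrix (Fin n) (Fin n) ℝ) (P : DynProg n S) :
    Fin (n + 1) → Matrix (Fin n) (Fin n) ℝ → S → Prop
  | root : Reachable Q P 0 0 P.init
  | step (l : Fin n) (W : Matrix (Fin n) (Fin n) ℝ) (s : S) (b : Bool) (s' : S)
      (h : Reachable Q P l.castSucc W s) (hs : P.step l s b = some s') :
      Reachable Q P l.succ (nextMatrix Q l W b) s'

/-- Nodes: the reachable states of each layer; equal states of the same layer are one node. -/
@[ext]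
structure Node {n : ℕ} {S : Type*} (Q : Matrix (Fin n) (Fin n) ℝ) (P : DynProg n S) where
  layer : Fin (n + 1)
  matrix : Matrix (Fin n) (Fin n) ℝ
  state : S
  reachable : Reachable Q P layer matrix state

/-- Arcs: one for every node and every feasible decision at that node. -/
@[ext]
structure Arc {n : ℕ} {S : Type*} (Q : Matrix (Fin n) (Fin n) ℝ) (P : DynProg n S) where
  layer : Fin n
  tail : Node Q P
  value : Bool
  head : Node Q P
  tail_layer : tail.layer = layer.castSucc
  head_layer : head.layer = layer.succ
  head_state : P.step layer tail.state value = some head.state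
  head_matrix : head.matrix = nextMatrix Q layer tail.matrix value

/-- The vector `u_a` stored in the arc `a`. -/
noncomputable def Arc.vec {n : ℕ} {S : Type*} {Q : Matrix (Fin n) (Fin n) ℝ} {P : DynProg n S}
    (a : Arc Q P) : Fin n → ℝ :=
  if a.value = true then transitionVector Q a.layer a.tail.matrix else 0

theorem finite_reachable {n : ℕ} {S : Type*} (Q : Matrix (Fin n) (Fin n) ℝ) (P : DynProg n S)
    (l : Fin (n + 1)) :
    {p : Matrix (Fin n) (Fin n) ℝ × S | Reachable Q P l p.1 p.2}.Finite := by
  induction l using Fin.induction with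
  | zero =>
    refine (Set.finite_singleton ((0 : Matrix (Fin n) (Fin n) ℝ), P.init)).subset ?_
    rintro ⟨W, s⟩ h
    simp only [Set.mem_ofPred_eq] at h
    generalize hl : (0 : Fin (n + 1)) = l at h
    cases h with
    | root => rfl
    | step l W s b s' h hs => exact absurd hl (Fin.succ_ne_zero l).symm
  | succ i ih =>
    refine ((ih.prod (Set.finite_univ (α := Bool))).image
      fun q => (nextMatrix Q i q.1.1 q.2, (P.step i q.1.2 q.2).getD P.init)).subset ?_
    rintro ⟨W, s⟩ h
    simp only [Set.mem_ofPred_eq] at h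
    generalize hl : i.succ = l at h
    cases h with
    | root => exact absurd hl (Fin.succ_ne_zero i)
    | step l W s b s' h hs =>
      obtain rfl := Fin.succ_injective _ hl
      exact ⟨((W, s), b), ⟨h, trivial⟩, by simp [hs]⟩

instance finite_node {n : ℕ} {S : Type*} (Q : Matrix (Fin n) (Fin n) ℝ) (P : DynProg n S) :
    Finite (Node Q P) := by
  have : ∀ l, Finite {p : Matrix (Fin n) (Fin n) ℝ × S | Reachable Q P l p.1 p.2} :=
    fun l => (finite_reachable Q P l).to_subtype
  refine Finite.of_injective (fun v : Node Q P => (⟨v.layer, ⟨(v.matrix, v.state), v.reachable⟩⟩ :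
    (l : Fin (n + 1)) × {p : Matrix (Fin n) (Fin n) ℝ × S | Reachable Q P l p.1 p.2})) ?_
  rintro ⟨l, W, s, h⟩ ⟨l', W', s', h'⟩ e
  simp only [Sigma.mk.injEq] at e
  obtain ⟨rfl, e⟩ := e
  simpa using e

instance finite_arc {n : ℕ} {S : Type*} (Q : Matrix (Fin n) (Fin n) ℝ) (P : DynProg n S) :
    Finite (Arc Q P) := by
  refine Finite.of_injective (fun a : Arc Q P => (a.layer, a.tail, a.value, a.head)) ?_
  intro a a' e
  simp only [Prod.mk.injEq] at e
  exact Arc.ext e.1 e.2.1 e.2.2.1 e.2.2.2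

noncomputable instance fintypeArc {n : ℕ} {S : Type*} (Q : Matrix (Fin n) (Fin n) ℝ)
    (P : DynProg n S) : Fintype (Arc Q P) := Fintype.ofFinite _

/-! ### The extended formulation -/

open Classical in
/-- The quotient `c / r` for `c, r ≥ 0` with the conventions `0 / 0 = 0` and `c / 0 = +∞` if `c ≠ 0`. -/
noncomputable def extDiv (c r : ℝ) : EReal :=
  if r = 0 then (if c = 0 then 0 else ⊤) else ((c / r : ℝ) : EReal)

open Classical in
/-- The system of the extended formulation in the variables `x, z, x₀` and the arc variables `r, w`. -/
structure HullSystem {n : ℕ} {S : Type*} (Q : Matrix (Fin n) (Fin n) ℝ) (P : DynProg n S)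
    (x z : Fin n → ℝ) (x0 : ℝ) (r w : Arc Q P → ℝ) : Prop where
  obj : ∑ a, extDiv (w a ^ 2) (r a) ≤ (x0 : EReal)
  continuous_part : x = ∑ a, w a • a.vec
  assignment : z = ∑ a with a.value = true, r a • (Pi.single a.layer 1 : Fin n → ℝ)
  flow : ∀ v : Node Q P, v.layer ≠ 0 → v.layer ≠ Fin.last n →
    ∑ a with a.head = v, r a = ∑ a with a.tail = v, r a
  first_layer : ∑ a with (a.layer : ℕ) = 0, r a = 1
  last_layer : ∑ a with (a.layer : ℕ) + 1 = n, r a = 1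
  nonneg : ∀ a, 0 ≤ r a

/-! ### Second-order cone programs -/

/-- An affine function of real variables indexed by `ι`. -/
structure AffineForm (ι : Type*) where
  coeff : ι → ℝ
  const : ℝ

def AffineForm.eval {ι : Type*} [Fintype ι] (f : AffineForm ι) (y : ι → ℝ) : ℝ :=
  ∑ i, f.coeff i * y i + f.const

/-- A finite system of affine equations `f = 0`, affine inequalities `0 ≤ f` and second-order cone
constraints `‖(f₁, …, f_d)‖₂ ≤ g` in real variables indexed by `ι`. -/
structure SOCP (ι : Type*) where
  numEq : ℕ
  eq : Fin numEq → AffineForm ι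
  numIneq : ℕ
  ineq : Fin numIneq → AffineForm ι
  numCone : ℕ
  coneDim : Fin numCone → ℕ
  coneVec : (k : Fin numCone) → Fin (coneDim k) → AffineForm ι
  coneTop : Fin numCone → AffineForm ι

structure SOCP.Feasible {ι : Type*} [Fintype ι] (F : SOCP ι) (y : ι → ℝ) : Prop where
  eq : ∀ k, (F.eq k).eval y = 0
  ineq : ∀ k, 0 ≤ (F.ineq k).eval y
  cone : ∀ k, Real.sqrt (∑ i, ((F.coneVec k i).eval y) ^ 2) ≤ (F.coneTop k).eval y

/-- The total number of scalar rows of the constraints. -/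
def SOCP.size {ι : Type*} (F : SOCP ι) : ℕ :=
  F.numEq + F.numIneq + ∑ k, (F.coneDim k + 1)

/-- The index type of the variables `(x, z, x₀)` and of three variables `r_a, w_a, s_a` per arc. -/
abbrev HullVar {n : ℕ} {S : Type*} (Q : Matrix (Fin n) (Fin n) ℝ) (P : DynProg n S) :=
  (Fin n ⊕ Fin n ⊕ Unit) ⊕ (Arc Q P ⊕ Arc Q P ⊕ Arc Q P)

/-- The values `(x, z, x₀, r, w, s)` as one vector. -/
def hullPoint {n : ℕ} {S : Type*} {Q : Matrix (Fin n) (Fin n) ℝ} {P : DynProg n S}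
    (x z : Fin n → ℝ) (x0 : ℝ) (r w s : Arc Q P → ℝ) : HullVar Q P → ℝ :=
  Sum.elim (Sum.elim x (Sum.elim z fun _ => x0)) (Sum.elim r (Sum.elim w s))

end MIQO

/-!
Along a path of the diagram the arc vectors are those of Gram–Schmidt for the form `xᵀQy`, applied to
the unit vectors `e_i` with `z_i = 1`: the matrix stored in a node is the sum of the `u uᵀ` over the
earlier arcs, apart from columns that meet only zero entries of the remaining columns of `Q`
(`IsPath.tail_matrix`), so that `W Q_ℓ` is the projection of `e_ℓ` onto the earlier vectors
(`IsPath.tail_matrix_mulVec`). They therefore form a `Q`-orthonormal basis of the vectors supported on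
`z` (`IsPath.orthonormal`, `IsPath.exists_coeff`), and `x = ∑ w_a u_a` has `xᵀQx = ∑ w_a²` if
`w_a = 0` on the arcs with decision `0`, and `xᵀQx ≤ ∑ w_a²` in general. Hence the
points of the mixed-integer set are the solutions of the system in which `r` is the unit flow along a
path.

The quotients `w_a² / r_a` are replaced by variables `s_a` with `w_a² ≤ r_a s_a`, `r_a, s_a ≥ 0`
(`LiftedSystem`). The projection of this conic system to `(x, z, x₀)` is convex, so it contains the
convex hull. Conversely, a flow of value one is a convex combination of unit flows along paths
(`IsFlow.exists_decomposition`), and giving each path the coefficients `w_a / r_a` writes a solution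
as a convex combination of points of the mixed-integer set. The projection is closed because
`0 ≤ r ≤ 1`, `0 ≤ s ≤ x₀` and `w² ≤ r s` confine the arc variables to a compact set while `x₀` is
bounded. Finally `w² ≤ r s` with `r, s ≥ 0` is the cone `‖(2w, r - s)‖ ≤ r + s`, and counting rows
gives the size bounds.
-/

namespace MIQO

open scoped Matrix

/-! ### Gram–Schmidt for a positive definite form -/

/-- The vectors produced by Gram–Schmidt from the unit vectors `e_i` with `b i = true` (the other
steps contribute `0`) are supported on the chosen coordinates up to the current one and are
orthonormal. The radicand is the squared length of the residual of `e_i`, which is positive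
because the `i`-th coordinate of the residual is `1`. -/
theorem gramSchmidt_orthonormal {n : ℕ} (B : LinearMap.BilinForm ℝ (Fin n → ℝ))
    (hsymm : ∀ x y, B x y = B y x) (hpos : ∀ x, x ≠ 0 → 0 < B x x)
    (b : Fin n → Bool) (u : Fin n → Fin n → ℝ) (h0 : ∀ i, b i = false → u i = 0)
    (h1 : ∀ i, b i = true → u i =
      (1 / Real.sqrt (B (Pi.single i 1) (Pi.single i 1)
        - ∑ k ∈ Finset.Iio i, B (u k) (Pi.single i 1) ^ 2)) •
      (-(∑ k ∈ Finset.Iio i, B (u k) (Pi.single i 1) • u k) + Pi.single i 1)) (i : Fin n) :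
    (∀ a, i < a → u i a = 0) ∧ (∀ a, b a = false → u i a = 0) ∧
      (∀ k < i, B (u k) (u i) = 0) ∧ (b i = true → B (u i) (u i) = 1) ∧
      (b i = true → 0 < B (Pi.single i 1) (Pi.single i 1)
        - ∑ k ∈ Finset.Iio i, B (u k) (Pi.single i 1) ^ 2) := by
  induction i using WellFoundedLT.induction with
  | ind i ih =>
  cases hb : b i with
  | false => simp [h0 i hb]
  | true =>
    set e : Fin n → ℝ := Pi.single i 1 with he
    set d : ℝ := B e e - ∑ k ∈ Finset.Iio i, B (u k) e ^ 2 with hd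
    set v : Fin n → ℝ := -(∑ k ∈ Finset.Iio i, B (u k) e • u k) + e with hv
    have hui : u i = (1 / Real.sqrt d) • v := h1 i hb
    have hea : ∀ a, a ≠ i → e a = 0 := fun a ha => by simp [he, ha]
    have hei : e i = 1 := by simp [he]
    have hvi : v i = 1 := by
      have : ∑ k ∈ Finset.Iio i, B (u k) e * u k i = 0 :=
        Finset.sum_eq_zero fun k hk => by
          rw [(ih k (Finset.mem_Iio.1 hk)).1 i (Finset.mem_Iio.1 hk), mul_zero]
      simp [hv, hei, this]
    have hvorth : ∀ k < i, B (u k) v = 0 := by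
      intro k hk
      cases hbk : b k with
      | false => simp [h0 k hbk]
      | true =>
        have : ∑ j ∈ Finset.Iio i, B (u j) e * B (u k) (u j) = B (u k) e := by
          rw [Finset.sum_eq_single k]
          · rw [(ih k hk).2.2.2.1 hbk, mul_one]
          · intro j hj hjk
            rcases lt_or_gt_of_ne hjk with h | h
            · rw [hsymm, hsymm (u k), (ih k hk).2.2.1 j h, mul_zero]
            · rw [(ih j (Finset.mem_Iio.1 hj)).2.2.1 k h, mul_zero]
          · exact fun h => absurd (Finset.mem_Iio.2 hk) h
        simp [hv, map_sum, this]
    -- `v` is orthogonal to the earlier vectors, hence `B v v = B e v`, and this expands to `d`.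
    have hvv : B v v = d := by
      have h2 : B v v = B e v := by
        have h3 : ∑ k ∈ Finset.Iio i, B v (B (u k) e • u k) = 0 :=
          Finset.sum_eq_zero fun k hk => by
            rw [map_smul, hsymm v, hvorth k (Finset.mem_Iio.1 hk), smul_zero]
        rw [hsymm e]
        conv_lhs => arg 2; rw [hv]
        rw [map_add, map_neg, map_sum, h3, neg_zero, zero_add]
      rw [h2, hd, hv, map_add, map_neg, map_sum, neg_add_eq_sub]
      congr 1
      refine Finset.sum_congr rfl fun k _ => ?_
      rw [map_smul, hsymm e, smul_eq_mul, sq]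
    have hdpos : 0 < d := by
      rw [← hvv]
      refine hpos v fun h => ?_
      rw [h] at hvi
      simp at hvi
    refine ⟨fun a ha => ?_, fun a ha => ?_, fun k hk => ?_, fun _ => ?_, fun _ => hdpos⟩
    · have : ∑ k ∈ Finset.Iio i, B (u k) e * u k a = 0 :=
        Finset.sum_eq_zero fun k hk => by
          rw [(ih k (Finset.mem_Iio.1 hk)).1 a ((Finset.mem_Iio.1 hk).trans ha), mul_zero]
      simp [hui, hv, hea a ha.ne', this]
    · have : ∑ k ∈ Finset.Iio i, B (u k) e * u k a = 0 :=
        Finset.sum_eq_zero fun k hk => by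
          rw [(ih k (Finset.mem_Iio.1 hk)).2.1 a ha, mul_zero]
      have hai : a ≠ i := by
        rintro rfl
        simp [hb] at ha
      simp [hui, hv, hea a hai, this]
    · rw [hui, map_smul, hvorth k hk, smul_zero]
    · rw [hui]
      simp only [map_smul, LinearMap.smul_apply, hvv, smul_eq_mul]
      have := Real.mul_self_sqrt hdpos.le
      have h3 := Real.sqrt_pos.2 hdpos
      field_simp
      rw [sq, this]

/-- Every vector supported on the chosen coordinates is a combination of the Gram–Schmidt vectors
with coefficients on the chosen coordinates. -/
theorem gramSchmidt_span {n : ℕ} (B : LinearMap.BilinForm ℝ (Fin n → ℝ))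
    (hsymm : ∀ x y, B x y = B y x) (hpos : ∀ x, x ≠ 0 → 0 < B x x)
    (b : Fin n → Bool) (u : Fin n → Fin n → ℝ) (h0 : ∀ i, b i = false → u i = 0)
    (h1 : ∀ i, b i = true → u i =
      (1 / Real.sqrt (B (Pi.single i 1) (Pi.single i 1)
        - ∑ k ∈ Finset.Iio i, B (u k) (Pi.single i 1) ^ 2)) •
      (-(∑ k ∈ Finset.Iio i, B (u k) (Pi.single i 1) • u k) + Pi.single i 1))
    (x : Fin n → ℝ) (hx : ∀ i, b i = false → x i = 0) :
    ∃ c : Fin n → ℝ, x = ∑ i, c i • u i ∧ ∀ i, b i = false → c i = 0 := by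
  have he : ∀ i, b i = true → (Pi.single i 1 : Fin n → ℝ) ∈ Submodule.span ℝ (Set.range u) := by
    intro i hb
    have hd := (gramSchmidt_orthonormal B hsymm hpos b u h0 h1 i).2.2.2.2 hb
    have hs := (Real.sqrt_pos.2 hd).ne'
    have hi := congrArg (fun y => Real.sqrt (B (Pi.single i 1) (Pi.single i 1)
        - ∑ k ∈ Finset.Iio i, B (u k) (Pi.single i 1) ^ 2) • y) (h1 i hb)
    simp only [smul_smul, mul_one_div_cancel hs, one_smul] at hi
    rw [eq_neg_add_iff_add_eq] at hi
    rw [← hi]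
    exact Submodule.add_mem _ (Submodule.sum_mem _ fun k _ =>
      Submodule.smul_mem _ _ (Submodule.subset_span ⟨k, rfl⟩))
      (Submodule.smul_mem _ _ (Submodule.subset_span ⟨i, rfl⟩))
  have hxs : x ∈ Submodule.span ℝ (Set.range u) := by
    rw [pi_eq_sum_univ' x]
    refine Submodule.sum_mem _ fun i _ => ?_
    cases hb : b i with
    | false => simp [hx i hb]
    | true =>
      convert Submodule.smul_mem _ (x i) (he i hb) using 2
  obtain ⟨c, hc⟩ := (Submodule.mem_span_range_iff_exists_fun ℝ).1 hxs
  refine ⟨fun i => if b i = true then c i else 0, ?_, fun i hi => by simp [hi]⟩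
  rw [← hc]
  refine Finset.sum_congr rfl fun i _ => ?_
  cases hb : b i with
  | false => simp [h0 i hb]
  | true => simp only [hb, if_true]

/-- The Pythagorean theorem for a combination of orthogonal vectors. -/
theorem form_sum_smul {n : ℕ} (B : LinearMap.BilinForm ℝ (Fin n → ℝ))
    (hsymm : ∀ x y, B x y = B y x) (u : Fin n → Fin n → ℝ)
    (horth : ∀ i, ∀ k < i, B (u k) (u i) = 0) (c : Fin n → ℝ) :
    B (∑ i, c i • u i) (∑ i, c i • u i) = ∑ i, c i ^ 2 * B (u i) (u i) := by
  rw [map_sum]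
  refine Finset.sum_congr rfl fun i _ => ?_
  rw [map_smul, map_sum, LinearMap.sum_apply, Finset.sum_eq_single i]
  · simp only [map_smul, LinearMap.smul_apply, smul_eq_mul]
    ring
  · intro j _ hj
    rw [map_smul, LinearMap.smul_apply]
    rcases lt_or_gt_of_ne hj with h | h
    · rw [horth i j h, smul_zero]
    · rw [hsymm, horth j i h, smul_zero]
  · simp

/-! ### Paths of the decision diagram -/

/-- A root-to-terminal path of the diagram, given by its arc in each layer. -/
structure IsPath {n : ℕ} {S : Type*} {Q : Matrix (Fin n) (Fin n) ℝ} {P : DynProg n S}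
    (p : Fin n → Arc Q P) : Prop where
  layer : ∀ i, (p i).layer = i
  link : ∀ i j : Fin n, (i : ℕ) + 1 = j → (p i).head = (p j).tail

section

variable {n : ℕ} {S : Type*} {Q : Matrix (Fin n) (Fin n) ℝ} {P : DynProg n S}

theorem Reachable.eq_root {l : Fin (n + 1)} {W : Matrix (Fin n) (Fin n) ℝ} {s : S}
    (h : Reachable Q P l W s) (hl : l = 0) : W = 0 ∧ s = P.init := by
  cases h with
  | root => exact ⟨rfl, rfl⟩
  | step l W s b s' h hs => exact absurd hl (Fin.succ_ne_zero l)

theorem nextMatrix_apply_of_arc (a : Arc Q P) (i j : Fin n) :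
    nextMatrix Q a.layer a.tail.matrix a.value i j =
      if relevantIndex Q j ≤ (a.layer : WithBot (Fin n)) then 0
      else a.tail.matrix i j + a.vec i * a.vec j := by
  simp only [nextMatrix, Arc.vec, Matrix.of_apply]
  cases a.value <;> simp

/-- The matrix met by a path before stage `i` is the sum of the products `u uᵀ` over its earlier
arcs, except for the columns that the compression has erased. -/
theorem IsPath.tail_matrix {p : Fin n → Arc Q P} (hp : IsPath p) (i : Fin n) (a c : Fin n) :
    (p i).tail.matrix a c = if relevantIndex Q c < (i : WithBot (Fin n)) then 0
      else ∑ k ∈ Finset.Iio i, (p k).vec a * (p k).vec c := by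
  obtain ⟨m, hm⟩ := i
  induction m generalizing a c with
  | zero =>
    have h0 : (p ⟨0, hm⟩).tail.layer = 0 := by
      rw [(p ⟨0, hm⟩).tail_layer, hp.layer]
      rfl
    have hempty : Finset.Iio (⟨0, hm⟩ : Fin n) = ∅ := by
      ext k
      simp [Fin.lt_def]
    rw [((p ⟨0, hm⟩).tail.reachable.eq_root h0).1, hempty]
    simp
  | succ m ih =>
    have hm' : m < n := by omega
    -- The columns erased before stage `m + 1` are those with relevant index at most `m`; since the
    -- condition only weakens with `m`, an erased column stays erased.
    have hlt : relevantIndex Q c < ((⟨m + 1, hm⟩ : Fin n) : WithBot (Fin n)) ↔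
        relevantIndex Q c ≤ ((⟨m, hm'⟩ : Fin n) : WithBot (Fin n)) := by
      cases relevantIndex Q c with
      | bot => simp
      | coe k =>
        rw [WithBot.coe_lt_coe, WithBot.coe_le_coe, Fin.lt_def, Fin.le_def]
        exact Nat.lt_succ_iff
    have hins : Finset.Iio (⟨m + 1, hm⟩ : Fin n) = insert ⟨m, hm'⟩ (Finset.Iio ⟨m, hm'⟩) := by
      ext k
      simp only [Finset.mem_Iio, Finset.mem_insert, Fin.lt_def, Fin.ext_iff]
      omega
    rw [← hp.link ⟨m, hm'⟩ ⟨m + 1, hm⟩ rfl, (p ⟨m, hm'⟩).head_matrix, nextMatrix_apply_of_arc,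
      hp.layer, ih a c hm', hins, Finset.sum_insert (by simp)]
    simp only [hlt]
    split_ifs with h1 h2
    · rfl
    · exact absurd h2.le h1
    · rw [add_comm]

/-- The erased columns do not matter: they meet zero entries of the column `Q_i`. -/
theorem IsPath.tail_matrix_mulVec {p : Fin n → Arc Q P} (hp : IsPath p) (i : Fin n) :
    (p i).tail.matrix *ᵥ (fun a => Q a i) =
      ∑ k ∈ Finset.Iio i, ((p k).vec ⬝ᵥ fun a => Q a i) • (p k).vec := by
  ext a
  simp only [Matrix.mulVec, dotProduct, Finset.sum_apply, Pi.smul_apply, smul_eq_mul,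
    Finset.sum_mul]
  rw [Finset.sum_comm]
  refine Finset.sum_congr rfl fun c _ => ?_
  rw [hp.tail_matrix]
  split_ifs with h
  · have hQ : Q c i = 0 := by
      by_contra hne
      exact absurd (Finset.le_max (by simpa using hne)) (not_le.2 h)
    simp [hQ]
  · rw [Finset.sum_mul]
    exact Finset.sum_congr rfl fun k _ => by ring

theorem toBilin'_single (x : Fin n → ℝ) (i : Fin n) :
    Matrix.toBilin' Q x (Pi.single i 1) = x ⬝ᵥ fun a => Q a i := by
  rw [Matrix.toBilin'_apply', Matrix.mulVec_single_one]
  rfl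

theorem Arc.vec_eq_zero (a : Arc Q P) (h : a.value = false) : a.vec = 0 := by
  simp [Arc.vec, h]

/-- The vectors along a path are those of Gram–Schmidt for the form `xᵀQy`, applied to the unit
vectors of the chosen coordinates. -/
theorem IsPath.vec_eq {p : Fin n → Arc Q P} (hp : IsPath p) (i : Fin n)
    (h : (p i).value = true) : (p i).vec =
      (1 / Real.sqrt (Matrix.toBilin' Q (Pi.single i 1) (Pi.single i 1)
        - ∑ k ∈ Finset.Iio i, Matrix.toBilin' Q (p k).vec (Pi.single i 1) ^ 2)) •
      (-(∑ k ∈ Finset.Iio i, Matrix.toBilin' Q (p k).vec (Pi.single i 1) • (p k).vec)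
        + Pi.single i 1) := by
  have hii : (Pi.single i 1 : Fin n → ℝ) ⬝ᵥ (fun a => Q a i) = Q i i := by simp
  simp only [toBilin'_single, hii]
  conv_lhs => rw [Arc.vec, if_pos h, transitionVector, hp.layer, hp.tail_matrix_mulVec,
    dotProduct_sum]
  congr 4
  refine Finset.sum_congr rfl fun k _ => ?_
  rw [dotProduct_smul, smul_eq_mul, dotProduct_comm, sq]

theorem toBilin'_symm (hQ : Q.PosDef) (x y : Fin n → ℝ) :
    Matrix.toBilin' Q x y = Matrix.toBilin' Q y x := by
  have hT : Qᵀ = Q := by simpa using hQ.isHermitian.eq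
  rw [Matrix.toBilin'_apply', Matrix.toBilin'_apply', Matrix.dotProduct_mulVec,
    ← Matrix.mulVec_transpose, hT, dotProduct_comm]

theorem toBilin'_self_pos (hQ : Q.PosDef) (x : Fin n → ℝ) (hx : x ≠ 0) :
    0 < Matrix.toBilin' Q x x := by
  rw [Matrix.toBilin'_apply']
  simpa using hQ.dotProduct_mulVec_pos hx

/-- The vectors of the arcs with decision `1` on a path are `Q`-orthonormal and supported on the
coordinates that the path chooses. -/
theorem IsPath.orthonormal (hQ : Q.PosDef) {p : Fin n → Arc Q P} (hp : IsPath p) (i : Fin n) :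
    (∀ a, (p a).value = false → (p i).vec a = 0) ∧
      (∀ k < i, Matrix.toBilin' Q (p k).vec (p i).vec = 0) ∧
      ((p i).value = true → Matrix.toBilin' Q (p i).vec (p i).vec = 1) := by
  have h := gramSchmidt_orthonormal (Matrix.toBilin' Q) (toBilin'_symm hQ)
    (toBilin'_self_pos hQ) (fun i => (p i).value) (fun i => (p i).vec)
    (fun i => (p i).vec_eq_zero) (fun i => hp.vec_eq i) i
  exact ⟨h.2.1, h.2.2.1, h.2.2.2.1⟩

/-- The quadratic form of a combination of the vectors of a path is at most the sum of squares of
the coefficients. -/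
theorem IsPath.quadForm_le (hQ : Q.PosDef) {p : Fin n → Arc Q P} (hp : IsPath p)
    (c : Fin n → ℝ) :
    (∑ i, c i • (p i).vec) ⬝ᵥ (Q *ᵥ ∑ i, c i • (p i).vec) ≤ ∑ i, c i ^ 2 := by
  rw [← Matrix.toBilin'_apply', form_sum_smul _ (toBilin'_symm hQ) (fun i => (p i).vec)
    (fun i => (hp.orthonormal hQ i).2.1)]
  refine Finset.sum_le_sum fun i _ => ?_
  cases h : (p i).value with
  | false =>
    rw [(p i).vec_eq_zero h]
    simpa using sq_nonneg (c i)
  | true => rw [(hp.orthonormal hQ i).2.2 h, mul_one]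

/-- A vector vanishing where the path decides `0` is a combination of the vectors of the path, and
then its quadratic form is the sum of squares of the coefficients. -/
theorem IsPath.exists_coeff (hQ : Q.PosDef) {p : Fin n → Arc Q P} (hp : IsPath p)
    (x : Fin n → ℝ) (hx : ∀ i, (p i).value = false → x i = 0) :
    ∃ c : Fin n → ℝ, x = ∑ i, c i • (p i).vec ∧ x ⬝ᵥ (Q *ᵥ x) = ∑ i, c i ^ 2 := by
  obtain ⟨c, hc, hc0⟩ := gramSchmidt_span (Matrix.toBilin' Q) (toBilin'_symm hQ)
    (toBilin'_self_pos hQ) (fun i => (p i).value) (fun i => (p i).vec)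
    (fun i => (p i).vec_eq_zero) (fun i => hp.vec_eq i) x hx
  refine ⟨c, hc, ?_⟩
  rw [← Matrix.toBilin'_apply', hc, form_sum_smul _ (toBilin'_symm hQ) (fun i => (p i).vec)
    (fun i => (hp.orthonormal hQ i).2.1)]
  refine Finset.sum_congr rfl fun i _ => ?_
  cases h : (p i).value with
  | false => simp [hc0 i h]
  | true => rw [(hp.orthonormal hQ i).2.2 h, mul_one]

/-- The decisions along a path are accepted by the dynamic program. -/
theorem IsPath.accepts {p : Fin n → Arc Q P} (hp : IsPath p) :
    P.Accepts fun i => (p i).value := by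
  refine ⟨Fin.cases P.init fun i => (p i).head.state, rfl, fun i => ?_⟩
  have ht : (Fin.cases P.init (fun i => (p i).head.state) i.castSucc : S)
      = (p i).tail.state := by
    obtain ⟨m, hm⟩ := i
    cases m with
    | zero =>
      have h0 : (p ⟨0, hm⟩).tail.layer = 0 := by
        rw [(p ⟨0, hm⟩).tail_layer, hp.layer]
        rfl
      exact ((p ⟨0, hm⟩).tail.reachable.eq_root h0).2.symm
    | succ m => exact congrArg Node.state (hp.link ⟨m, by omega⟩ ⟨m + 1, hm⟩ rfl)
  have hs := (p i).head_state
  rw [hp.layer] at hs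
  exact (congrArg (fun s => P.step i s (p i).value) ht).trans hs

/-- Accepted decisions are the decisions along a path. -/
theorem exists_path_of_accepts {b : Fin n → Bool} (hb : P.Accepts b) :
    ∃ p : Fin n → Arc Q P, IsPath p ∧ ∀ i, (p i).value = b i := by
  obtain ⟨σ, h0, hσ⟩ := hb
  let W : Fin (n + 1) → Matrix (Fin n) (Fin n) ℝ :=
    Fin.induction 0 fun i M => nextMatrix Q i M (b i)
  have hW : ∀ i : Fin n, W i.succ = nextMatrix Q i (W i.castSucc) (b i) :=
    fun i => Fin.induction_succ _ _ i
  have hreach : ∀ l, Reachable Q P l (W l) (σ l) := by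
    intro l
    induction l using Fin.induction with
    | zero =>
      rw [h0]
      exact Reachable.root
    | succ i ih =>
      rw [hW]
      exact Reachable.step i _ _ _ _ ih (hσ i)
  let N : Fin (n + 1) → Node Q P := fun l => ⟨l, W l, σ l, hreach l⟩
  refine ⟨fun i => ⟨i, N i.castSucc, b i, N i.succ, rfl, rfl, hσ i, hW i⟩, ⟨fun _ => rfl, ?_⟩,
    fun _ => rfl⟩
  intro i j hij
  exact congrArg N (Fin.ext hij)

/-! ### Decomposition of flows into paths -/

open Classical in
/-- Flow conservation at the nodes that are neither in the first nor in the last layer. -/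
def IsFlow (r : Arc Q P → ℝ) : Prop :=
  ∀ v : Node Q P, v.layer ≠ 0 → v.layer ≠ Fin.last n →
    ∑ a with a.head = v, r a = ∑ a with a.tail = v, r a

open Classical in
/-- The unit flow along a path. -/
noncomputable def pathFlow (p : Fin n → Arc Q P) (a : Arc Q P) : ℝ :=
  if p a.layer = a then 1 else 0

theorem IsPath.pathFlow_apply {p : Fin n → Arc Q P} (hp : IsPath p) (i : Fin n) :
    pathFlow p (p i) = 1 := by
  rw [pathFlow, hp.layer, if_pos rfl]

theorem pathFlow_nonneg (p : Fin n → Arc Q P) (a : Arc Q P) : 0 ≤ pathFlow p a := by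
  unfold pathFlow
  split_ifs <;> norm_num

open Classical in
theorem IsPath.sum_pathFlow_smul {E : Type*} [AddCommGroup E] [Module ℝ E]
    {p : Fin n → Arc Q P} (hp : IsPath p) (f : Arc Q P → E) :
    ∑ a, pathFlow p a • f a = ∑ i, f (p i) := by
  have hinj : Function.Injective p := fun i j h => by
    rw [← hp.layer i, h, hp.layer]
  rw [← Finset.sum_image (s := Finset.univ) (g := p) (f := f) fun i _ j _ h => hinj h]
  rw [← Finset.sum_subset (Finset.subset_univ (Finset.univ.image p))]
  · refine Finset.sum_congr rfl fun a ha => ?_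
    obtain ⟨i, -, rfl⟩ := Finset.mem_image.1 ha
    rw [hp.pathFlow_apply, one_smul]
  · intro a _ ha
    rw [pathFlow, if_neg, zero_smul]
    exact fun h => ha (Finset.mem_image.2 ⟨_, Finset.mem_univ _, h⟩)

theorem IsPath.sum_pathFlow_filter {p : Fin n → Arc Q P} (hp : IsPath p) (q : Arc Q P → Prop)
    [DecidablePred q] : ∑ a with q a, pathFlow p a = ∑ i, if q (p i) then (1 : ℝ) else 0 := by
  rw [Finset.sum_filter, ← hp.sum_pathFlow_smul fun a => if q a then (1 : ℝ) else 0]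
  simp

theorem IsPath.isFlow {p : Fin n → Arc Q P} (hp : IsPath p) : IsFlow (pathFlow p) := by
  classical
  intro v h0 hl
  rw [hp.sum_pathFlow_filter, hp.sum_pathFlow_filter]
  have h0' : (v.layer : ℕ) ≠ 0 := fun h => h0 (Fin.ext h)
  have hl' : (v.layer : ℕ) ≠ n := fun h => hl (Fin.ext h)
  have hlt := v.layer.isLt
  have hlink := hp.link ⟨v.layer - 1, by omega⟩ ⟨v.layer, by omega⟩ (by simp; omega)
  rw [Finset.sum_eq_single (⟨v.layer - 1, by omega⟩ : Fin n),
    Finset.sum_eq_single (⟨v.layer, by omega⟩ : Fin n), hlink]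
  · intro j _ hj
    refine if_neg fun h => hj ?_
    have := (p j).tail_layer
    rw [h, hp.layer] at this
    exact Fin.ext (by simp [this])
  · simp
  · intro j _ hj
    refine if_neg fun h => hj ?_
    have := (p j).head_layer
    rw [h, hp.layer] at this
    exact Fin.ext (by simp [this])
  · simp

/-- The flow through all layers is the same. -/
theorem IsFlow.layer_succ {r : Arc Q P → ℝ} (hr : IsFlow r) (m : ℕ) (hm : m + 1 < n) :
    ∑ a : Arc Q P with (a.layer : ℕ) = m, r a = ∑ a : Arc Q P with (a.layer : ℕ) = m + 1, r a := by
  classical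
  let _ : Fintype (Node Q P) := Fintype.ofFinite _
  let t : Finset (Node Q P) := Finset.univ.filter fun v => (v.layer : ℕ) = m + 1
  rw [← Finset.sum_fiberwise_of_maps_to (g := Arc.head) (t := t),
    ← Finset.sum_fiberwise_of_maps_to (g := Arc.tail) (t := t)]
  · refine Finset.sum_congr rfl fun v hv => ?_
    have hv' : (v.layer : ℕ) = m + 1 := (Finset.mem_filter.1 hv).2
    have hflow := hr v (fun h => by simp [h] at hv') (fun h => by simp [h] at hv'; omega)
    rw [Finset.filter_filter, Finset.filter_filter]
    convert hflow using 2
    · ext a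
      simp only [Finset.mem_filter, Finset.mem_univ, true_and, and_iff_right_iff_imp]
      rintro rfl
      rw [a.head_layer] at hv'
      simpa using hv'
    · ext a
      simp only [Finset.mem_filter, Finset.mem_univ, true_and, and_iff_right_iff_imp]
      rintro rfl
      rw [a.tail_layer] at hv'
      simpa using hv'
  · intro a ha
    have := (Finset.mem_filter.1 ha).2
    simp [t, a.tail_layer, this]
  · intro a ha
    have := (Finset.mem_filter.1 ha).2
    simp [t, a.head_layer, this]

theorem IsFlow.layer_eq {r : Arc Q P → ℝ} (hr : IsFlow r) (m : ℕ) (hm : m < n) :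
    ∑ a : Arc Q P with (a.layer : ℕ) = m, r a = ∑ a : Arc Q P with (a.layer : ℕ) = 0, r a := by
  induction m with
  | zero => rfl
  | succ m ih => rw [← hr.layer_succ m hm, ih (by omega)]

/-- Starting from an arc of the first layer that carries flow, conservation lets one follow arcs
carrying flow down to the last layer. -/
theorem IsFlow.exists_path {r : Arc Q P → ℝ} (hr : IsFlow r) (hr0 : ∀ a, 0 ≤ r a)
    (a₀ : Arc Q P) (ha₀ : (a₀.layer : ℕ) = 0) (hpos : 0 < r a₀) :
    ∃ p : Fin n → Arc Q P, IsPath p ∧ ∀ i, 0 < r (p i) := by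
  classical
  have hnext : ∀ a : {a : Arc Q P // 0 < r a}, ∃ a' : {a : Arc Q P // 0 < r a},
      (a.1.layer : ℕ) + 1 < n → a'.1.tail = a.1.head := by
    rintro ⟨a, ha⟩
    by_cases h : (a.layer : ℕ) + 1 < n
    · have hflow := hr a.head (by rw [a.head_layer]; exact Fin.succ_ne_zero _)
        (by rw [a.head_layer]; intro h'; have := congrArg Fin.val h'; simp at this; omega)
      have hin : 0 < ∑ a' with a'.head = a.head, r a' :=
        Finset.sum_pos' (fun a' _ => hr0 a') ⟨a, by simp, ha⟩
      rw [hflow] at hin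
      obtain ⟨a', ha', hra'⟩ := Finset.exists_lt_of_sum_lt
        (f := fun _ : Arc Q P => (0 : ℝ)) (by simpa using hin)
      exact ⟨⟨a', hra'⟩, fun _ => (Finset.mem_filter.1 ha').2⟩
    · exact ⟨⟨a, ha⟩, fun h' => absurd h' h⟩
  choose f hf using hnext
  let q : ℕ → {a : Arc Q P // 0 < r a} := fun m => f^[m] ⟨a₀, hpos⟩
  have hq : ∀ m, q (m + 1) = f (q m) := fun m => Function.iterate_succ_apply' f m _
  have hlayer : ∀ m, m < n → ((q m).1.layer : ℕ) = m := by
    intro m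
    induction m with
    | zero => exact fun _ => ha₀
    | succ m ih =>
      intro hm
      have ihm := ih (by omega)
      have htail := hf (q m) (by omega)
      rw [← hq] at htail
      have h1 := (q (m + 1)).1.tail_layer
      rw [htail, (q m).1.head_layer] at h1
      have := congrArg Fin.val h1
      simp only [Fin.val_succ, Fin.val_castSucc] at this
      omega
  refine ⟨fun i => (q i).1, ⟨fun i => Fin.ext (hlayer i i.2), fun i j hij => ?_⟩,
    fun i => (q i).2⟩
  have h1 := hf (q i) (by rw [hlayer i i.2, hij]; exact j.2)
  rw [← hq, hij] at h1
  exact h1.symm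

open Classical in
/-- Every nonnegative flow is a nonnegative combination of unit flows along paths. As long as some
arc carries flow there is a path all of whose arcs do, and subtracting the smallest value on it
enlarges the set of arcs without flow. -/
theorem IsFlow.exists_decomposition (hn : 0 < n) {r : Arc Q P → ℝ} (hr : IsFlow r)
    (hr0 : ∀ a, 0 ≤ r a) :
    ∃ c : {p : Fin n → Arc Q P // IsPath p} → ℝ, (∀ p, 0 ≤ c p) ∧
      ∀ a, r a = ∑ p, c p * pathFlow p.1 a := by
  induction hk : (Finset.univ.filter fun a => r a ≠ 0).card using Nat.strong_induction_on
    generalizing r with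
  | _ k ih =>
  by_cases hz : ∀ a, r a = 0
  · exact ⟨0, fun _ => le_rfl, fun a => by simp [hz]⟩
  push Not at hz
  obtain ⟨a, ha⟩ := hz
  have hlay : 0 < ∑ a' : Arc Q P with (a'.layer : ℕ) = 0, r a' := by
    rw [← hr.layer_eq a.layer a.layer.2]
    exact Finset.sum_pos' (fun a' _ => hr0 a') ⟨a, by simp, lt_of_le_of_ne (hr0 a) ha.symm⟩
  obtain ⟨a₀, ha₀, hpos⟩ := Finset.exists_lt_of_sum_lt
    (f := fun _ : Arc Q P => (0 : ℝ)) (by simpa using hlay)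
  obtain ⟨p, hp, hppos⟩ := hr.exists_path hr0 a₀ (Finset.mem_filter.1 ha₀).2 hpos
  obtain ⟨i, -, hi⟩ := Finset.exists_min_image Finset.univ (fun i => r (p i))
    ⟨⟨0, hn⟩, Finset.mem_univ _⟩
  set m := r (p i) with hm
  let r' : Arc Q P → ℝ := fun a => r a - m * pathFlow p a
  have hr' : IsFlow r' := fun v h0 hl => by
    simp only [r', Finset.sum_sub_distrib, ← Finset.mul_sum]
    rw [hr v h0 hl, hp.isFlow v h0 hl]
  have hr'0 : ∀ a, 0 ≤ r' a := by
    intro a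
    by_cases h : p a.layer = a
    · have := hi a.layer (Finset.mem_univ _)
      rw [h] at this
      simpa [r', pathFlow, h] using this
    · simpa [r', pathFlow, h] using hr0 a
  have hlt : (Finset.univ.filter fun a => r' a ≠ 0).card < k := by
    rw [← hk]
    refine Finset.card_lt_card (Finset.ssubset_iff_of_subset ?_ |>.2 ⟨p i, ?_, ?_⟩)
    · intro a ha
      simp only [Finset.mem_filter, Finset.mem_univ, true_and] at ha ⊢
      intro h
      have := hr'0 a
      have h2 : r' a ≤ 0 := by
        simp only [r', h, zero_sub, neg_nonpos]
        exact mul_nonneg (hppos i).le (pathFlow_nonneg p a)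
      exact ha (le_antisymm h2 this)
    · simpa using (hppos i).ne'
    · simp [r', hp.pathFlow_apply, hm]
  obtain ⟨c, hc0, hc⟩ := ih _ hlt hr' hr'0 rfl
  refine ⟨fun p' => c p' + if p' = ⟨p, hp⟩ then m else 0, fun p' => ?_, fun a => ?_⟩
  · refine add_nonneg (hc0 p') ?_
    split_ifs
    exacts [(hppos i).le, le_rfl]
  · simp only [add_mul, Finset.sum_add_distrib, ← hc, ite_mul, zero_mul, Finset.sum_ite_eq',
      Finset.mem_univ, if_true, r']
    ring

/-! ### The lifted conic system -/

open Classical in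
/-- The extended formulation with an additional variable `s_a` bounding `w_a² / r_a`, so that the
nonlinear constraints become the rotated second-order cones `w_a² ≤ r_a s_a`, `r_a, s_a ≥ 0`. -/
structure LiftedSystem (Q : Matrix (Fin n) (Fin n) ℝ) (P : DynProg n S)
    (x z : Fin n → ℝ) (x0 : ℝ) (r w s : Arc Q P → ℝ) : Prop where
  obj : ∑ a, s a ≤ x0
  continuous_part : x = ∑ a, w a • a.vec
  assignment : z = ∑ a with a.value = true, r a • (Pi.single a.layer 1 : Fin n → ℝ)
  flow : IsFlow r
  first_layer : ∑ a with (a.layer : ℕ) = 0, r a = 1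
  last_layer : ∑ a with (a.layer : ℕ) + 1 = n, r a = 1
  nonneg : ∀ a, 0 ≤ r a
  nonneg' : ∀ a, 0 ≤ s a
  cone : ∀ a, w a ^ 2 ≤ r a * s a

theorem extDiv_nonneg {c r : ℝ} (hc : 0 ≤ c) (hr : 0 ≤ r) : 0 ≤ extDiv c r := by
  unfold extDiv
  split_ifs
  · exact le_rfl
  · exact le_top
  · exact_mod_cast div_nonneg hc hr

theorem extDiv_le_coe_iff {c r s : ℝ} (hc : 0 ≤ c) (hr : 0 ≤ r) :
    extDiv c r ≤ (s : EReal) ↔ 0 ≤ s ∧ c ≤ r * s := by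
  unfold extDiv
  split_ifs with h0 h1
  · simp [h0, h1]
  · simp only [top_le_iff, EReal.coe_ne_top, h0, zero_mul, false_iff, not_and, not_le]
    exact fun _ => lt_of_le_of_ne hc (Ne.symm h1)
  · have hpos : 0 < r := lt_of_le_of_ne hr (Ne.symm h0)
    rw [EReal.coe_le_coe_iff, div_le_iff₀ hpos, mul_comm s]
    refine ⟨fun h => ⟨?_, h⟩, fun h => h.2⟩
    exact nonneg_of_mul_nonneg_right (hc.trans h) hpos

theorem coe_sum_ereal {ι : Type*} (t : Finset ι) (f : ι → ℝ) :
    ((∑ i ∈ t, f i : ℝ) : EReal) = ∑ i ∈ t, (f i : EReal) := by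
  classical
  induction t using Finset.induction_on with
  | empty => simp
  | insert a t ha ih => rw [Finset.sum_insert ha, Finset.sum_insert ha, EReal.coe_add, ih]

theorem sum_extDiv_le_iff {ι : Type*} [Fintype ι] {c r : ι → ℝ} {x0 : ℝ} (hc : ∀ i, 0 ≤ c i)
    (hr : ∀ i, 0 ≤ r i) : ∑ i, extDiv (c i) (r i) ≤ (x0 : EReal) ↔
      ∃ s : ι → ℝ, ∑ i, s i ≤ x0 ∧ ∀ i, 0 ≤ s i ∧ c i ≤ r i * s i := by
  constructor
  · intro h
    have hfin : ∀ i, ∃ t : ℝ, extDiv (c i) (r i) = (t : EReal) := by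
      intro i
      have h1 : extDiv (c i) (r i) ≤ (x0 : EReal) :=
        (Finset.single_le_sum (f := fun i => extDiv (c i) (r i))
          (fun j _ => extDiv_nonneg (hc j) (hr j)) (Finset.mem_univ i)).trans h
      have h2 := extDiv_nonneg (hc i) (hr i)
      refine ⟨_, (EReal.coe_toReal (fun e => ?_) (fun e => ?_)).symm⟩
      · rw [e] at h1
        simp at h1
      · rw [e] at h2
        simp at h2
    choose s hs using hfin
    refine ⟨s, ?_, fun i => (extDiv_le_coe_iff (hc i) (hr i)).1 (hs i).le⟩
    simp only [hs] at h
    rw [← coe_sum_ereal] at h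
    exact_mod_cast h
  · rintro ⟨s, hsum, hs⟩
    calc ∑ i, extDiv (c i) (r i) ≤ ∑ i, (s i : EReal) :=
          Finset.sum_le_sum fun i _ => (extDiv_le_coe_iff (hc i) (hr i)).2 (hs i)
      _ = ((∑ i, s i : ℝ) : EReal) := (coe_sum_ereal _ _).symm
      _ ≤ x0 := by exact_mod_cast hsum

theorem hullSystem_iff_exists_lifted {x z : Fin n → ℝ} {x0 : ℝ} {r w : Arc Q P → ℝ} :
    HullSystem Q P x z x0 r w ↔ ∃ s, LiftedSystem Q P x z x0 r w s := by
  constructor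
  · intro h
    obtain ⟨s, hsum, hs⟩ := (sum_extDiv_le_iff (fun a => sq_nonneg (w a)) h.nonneg).1 h.obj
    exact ⟨s, hsum, h.continuous_part, h.assignment, h.flow, h.first_layer, h.last_layer,
      h.nonneg, fun a => (hs a).1, fun a => (hs a).2⟩
  · rintro ⟨s, h⟩
    exact ⟨(sum_extDiv_le_iff (fun a => sq_nonneg (w a)) h.nonneg).2
      ⟨s, h.obj, fun a => ⟨h.nonneg' a, h.cone a⟩⟩, h.continuous_part, h.assignment, h.flow,
      h.first_layer, h.last_layer, h.nonneg⟩

/-! ### The convex hull -/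

/-- The set of all `(x, z, x₀)` for which the lifted system is solvable. -/
def liftedProjection (Q : Matrix (Fin n) (Fin n) ℝ) (P : DynProg n S) :
    Set ((Fin n → ℝ) × (Fin n → ℝ) × ℝ) :=
  {y | ∃ r w s, LiftedSystem Q P y.1 y.2.1 y.2.2 r w s}

/-- The cone `w² ≤ r s`, `r, s ≥ 0` is convex. -/
theorem sq_combo_le_mul_combo {α β r w s r' w' s' : ℝ} (hα : 0 ≤ α) (hβ : 0 ≤ β)
    (hr : 0 ≤ r) (hs : 0 ≤ s) (hr' : 0 ≤ r') (hs' : 0 ≤ s') (h : w ^ 2 ≤ r * s)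
    (h' : w' ^ 2 ≤ r' * s') :
    (α * w + β * w') ^ 2 ≤ (α * r + β * r') * (α * s + β * s') := by
  -- The mixed term: `(w w')² ≤ (r s') (r' s)`, so arithmetic and geometric mean apply.
  have hcross : 2 * (w * w') ≤ r * s' + r' * s := by
    refine abs_le_of_sq_le_sq' ?_ (by positivity) |>.2
    have h1 : w ^ 2 * w' ^ 2 ≤ (r * s) * (r' * s') :=
      mul_le_mul h h' (sq_nonneg _) (mul_nonneg hr hs)
    nlinarith [sq_nonneg (r * s' - r' * s)]
  nlinarith [mul_le_mul_of_nonneg_left hcross (mul_nonneg hα hβ),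
    mul_le_mul_of_nonneg_left h (mul_nonneg hα hα), mul_le_mul_of_nonneg_left h' (mul_nonneg hβ hβ)]

theorem convex_liftedProjection : Convex ℝ (liftedProjection Q P) := by
  classical
  rintro ⟨x, z, x0⟩ ⟨r, w, s, h⟩ ⟨x', z', x0'⟩ ⟨r', w', s', h'⟩ α β hα hβ hαβ
  refine ⟨fun a => α * r a + β * r' a, fun a => α * w a + β * w' a,
    fun a => α * s a + β * s' a, ?_, ?_, ?_, ?_, ?_, ?_, fun a => ?_, fun a => ?_, fun a => ?_⟩
  · simp only [Finset.sum_add_distrib, ← Finset.mul_sum]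
    exact add_le_add (mul_le_mul_of_nonneg_left h.obj hα) (mul_le_mul_of_nonneg_left h'.obj hβ)
  · have e := h.continuous_part
    have e' := h'.continuous_part
    simp only at e e'
    simp only [Prod.smul_mk, Prod.mk_add_mk, add_smul, mul_smul, Finset.sum_add_distrib,
      ← Finset.smul_sum]
    rw [← e, ← e']
  · have e := h.assignment
    have e' := h'.assignment
    simp only at e e'
    simp only [Prod.smul_mk, Prod.mk_add_mk, add_smul, mul_smul, Finset.sum_add_distrib,
      ← Finset.smul_sum]
    rw [← e, ← e']
  · intro v h0 hl
    simp only [Finset.sum_add_distrib, ← Finset.mul_sum]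
    rw [h.flow v h0 hl, h'.flow v h0 hl]
  · simp only [Finset.sum_add_distrib, ← Finset.mul_sum]
    rw [h.first_layer, h'.first_layer, mul_one, mul_one, hαβ]
  · simp only [Finset.sum_add_distrib, ← Finset.mul_sum]
    rw [h.last_layer, h'.last_layer, mul_one, mul_one, hαβ]
  · exact add_nonneg (mul_nonneg hα (h.nonneg a)) (mul_nonneg hβ (h'.nonneg a))
  · exact add_nonneg (mul_nonneg hα (h.nonneg' a)) (mul_nonneg hβ (h'.nonneg' a))
  · exact sq_combo_le_mul_combo hα hβ (h.nonneg a) (h.nonneg' a) (h'.nonneg a) (h'.nonneg' a)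
      (h.cone a) (h'.cone a)

open Classical in
theorem IsPath.bitVec_value_eq {p : Fin n → Arc Q P} (hp : IsPath p) :
    bitVec (fun i => (p i).value) =
      ∑ i, if (p i).value = true then (Pi.single (p i).layer 1 : Fin n → ℝ) else 0 := by
  ext i
  simp only [bitVec, Finset.sum_apply, hp.layer]
  rw [Finset.sum_eq_single i]
  · split_ifs <;> simp
  · intro j _ hj
    split_ifs <;> simp [hj.symm]
  · simp

theorem IsPath.sum_layer_eq_one {p : Fin n → Arc Q P} (hp : IsPath p) (i : Fin n) :
    ∑ k, (if ((p k).layer : ℕ) = i then (1 : ℝ) else 0) = 1 := by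
  simp [hp.layer, Fin.val_inj]

/-- A point of the mixed-integer set solves the lifted system with the unit flow along the path of
its binary part and with the Gram–Schmidt coefficients of its continuous part. -/
theorem mixedSet_subset_liftedProjection (hn : 0 < n) (hQ : Q.PosDef) {Z : Set (Fin n → ℝ)}
    (hP : P.Represents Z) : mixedSet Q Z ⊆ liftedProjection Q P := by
  classical
  rintro ⟨x, z, x0⟩ ⟨-, hobj, hcomp, hz⟩
  simp only at hobj hcomp hz
  rw [hP] at hz
  obtain ⟨b, hb, rfl⟩ := hz
  obtain ⟨p, hp, hpb⟩ := exists_path_of_accepts hb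
  obtain ⟨c, hxc, hquad⟩ := hp.exists_coeff hQ x fun i hi => by
    have := hcomp i
    rw [hpb] at hi
    simpa [bitVec, hi] using this
  refine ⟨pathFlow p, fun a => pathFlow p a * c a.layer, fun a => pathFlow p a * c a.layer ^ 2,
    ?_, ?_, ?_, hp.isFlow, ?_, ?_, pathFlow_nonneg p,
    fun a => mul_nonneg (pathFlow_nonneg p a) (sq_nonneg _), fun a => ?_⟩
  · have := hp.sum_pathFlow_smul fun a => c a.layer ^ 2
    simp only [smul_eq_mul, hp.layer] at this
    rw [this, ← hquad]
    exact hobj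
  · have := hp.sum_pathFlow_smul fun a => c a.layer • a.vec
    simp only [hp.layer, smul_smul] at this
    rw [this]
    exact hxc
  · have hval : (fun i => (p i).value) = b := funext hpb
    have := hp.sum_pathFlow_smul fun a =>
      if a.value = true then (Pi.single a.layer 1 : Fin n → ℝ) else 0
    simp only [smul_ite, smul_zero] at this
    rw [Finset.sum_filter, this, ← hp.bitVec_value_eq, hval]
  · rw [hp.sum_pathFlow_filter]
    exact hp.sum_layer_eq_one ⟨0, hn⟩
  · rw [hp.sum_pathFlow_filter]
    refine Eq.trans ?_ (hp.sum_layer_eq_one ⟨n - 1, by omega⟩)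
    refine Finset.sum_congr rfl fun k _ => if_congr ?_ rfl rfl
    simp only
    omega
  · refine le_of_eq ?_
    unfold pathFlow
    split_ifs <;> simp

/-- A solution of the lifted system splits along a path decomposition of `r`: the path through
the arcs `a` receives the coefficients `w_a / r_a`, and the slack of the objective is given to all
paths alike. -/
theorem liftedProjection_subset_convexHull (hn : 0 < n) (hQ : Q.PosDef) {Z : Set (Fin n → ℝ)}
    (hP : P.Represents Z) : liftedProjection Q P ⊆ convexHull ℝ (mixedSet Q Z) := by
  classical
  rintro ⟨x, z, x0⟩ ⟨r, w, s, h⟩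
  obtain ⟨c, hc0, hc⟩ := h.flow.exists_decomposition hn h.nonneg
  -- Summing an arc function over the paths of the decomposition weighs it with `r`.
  have hsum : ∀ {E : Type} [AddCommGroup E] [Module ℝ E] (g : Arc Q P → E),
      ∑ p, c p • ∑ i, g (p.1 i) = ∑ a, r a • g a := by
    intro E _ _ g
    simp only [hc, Finset.sum_smul, mul_smul]
    rw [Finset.sum_comm]
    refine Finset.sum_congr rfl fun p _ => ?_
    rw [← Finset.smul_sum, p.2.sum_pathFlow_smul]
  have hc1 : ∑ p, c p = 1 := by
    have := hsum fun a => if (a.layer : ℕ) = 0 then (1 : ℝ) else 0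
    have hone := fun p : {p : Fin n → Arc Q P // IsPath p} => p.2.sum_layer_eq_one ⟨0, hn⟩
    simp only at hone
    simp only [hone, smul_eq_mul, mul_one, mul_ite, mul_zero] at this
    rw [this, ← Finset.sum_filter]
    exact h.first_layer
  let f : Arc Q P → ℝ := fun a => w a / r a
  -- Where `r a = 0` the junk value `f a = 0` is right, as the cone forces `w a = 0`.
  have hrf : ∀ a, r a * f a = w a := by
    intro a
    rcases eq_or_ne (r a) 0 with h0 | h0
    · have := h.cone a
      rw [h0, zero_mul] at this
      rw [h0, zero_mul, pow_eq_zero_iff two_ne_zero |>.1 (le_antisymm this (sq_nonneg _))]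
    · exact mul_div_cancel₀ _ h0
  have hrf2 : ∀ a, r a * f a ^ 2 ≤ s a := by
    intro a
    rcases (h.nonneg a).eq_or_lt with h0 | h0
    · rw [← h0, zero_mul]
      exact h.nonneg' a
    · refine le_of_mul_le_mul_left ?_ h0
      calc r a * (r a * f a ^ 2) = (r a * f a) ^ 2 := by ring
        _ ≤ r a * s a := by
          rw [hrf]
          exact h.cone a
  set δ : ℝ := x0 - ∑ a, r a * f a ^ 2 with hδ
  have hδ0 : 0 ≤ δ := sub_nonneg.2 ((Finset.sum_le_sum fun a _ => hrf2 a).trans h.obj)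
  let pt : {p : Fin n → Arc Q P // IsPath p} → (Fin n → ℝ) × (Fin n → ℝ) × ℝ := fun p =>
    (∑ i, f (p.1 i) • (p.1 i).vec, bitVec fun i => (p.1 i).value, ∑ i, f (p.1 i) ^ 2 + δ)
  have hpt : ∀ p, pt p ∈ mixedSet Q Z := by
    intro p
    refine ⟨fun i => ?_, ?_, fun i => ?_, ?_⟩
    · simp only [pt, bitVec]
      split_ifs <;> simp
    · exact (p.2.quadForm_le hQ fun i => f (p.1 i)).trans (le_add_of_nonneg_right hδ0)
    · cases hi : (p.1 i).value with
      | true => simp [pt, bitVec, hi]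
      | false =>
        refine mul_eq_zero_of_left ?_ _
        simp only [pt, Finset.sum_apply, Pi.smul_apply]
        exact Finset.sum_eq_zero fun k _ => by rw [(p.2.orthonormal hQ k).1 i hi, smul_zero]
    · rw [hP]
      exact ⟨_, p.2.accepts, rfl⟩
  have hcomb : (x, z, x0) = ∑ p, c p • pt p := by
    refine Prod.ext ?_ (Prod.ext ?_ ?_)
    · rw [Prod.fst_sum]
      simp only [Prod.smul_fst, pt]
      rw [hsum fun a => f a • a.vec]
      simp only [smul_smul, hrf]
      exact h.continuous_part
    · rw [Prod.snd_sum, Prod.fst_sum]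
      simp only [Prod.smul_fst, Prod.smul_snd, pt, fun p : {p : Fin n → Arc Q P // IsPath p} => p.2.bitVec_value_eq]
      rw [hsum fun a => if a.value = true then (Pi.single a.layer 1 : Fin n → ℝ) else 0]
      simp only [smul_ite, smul_zero, ← Finset.sum_filter]
      exact h.assignment
    · rw [Prod.snd_sum, Prod.snd_sum]
      simp only [Prod.smul_snd, pt, smul_add, Finset.sum_add_distrib]
      rw [hsum fun a => f a ^ 2, ← Finset.sum_smul, hc1, one_smul, hδ]
      simp only [smul_eq_mul]
      ring
  rw [hcomb]
  exact (convex_convexHull ℝ _).sum_mem (fun p _ => hc0 p) hc1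
    fun p _ => subset_convexHull ℝ _ (hpt p)

theorem convexHull_mixedSet_eq (hn : 0 < n) (hQ : Q.PosDef) {Z : Set (Fin n → ℝ)}
    (hP : P.Represents Z) : convexHull ℝ (mixedSet Q Z) = liftedProjection Q P :=
  (convexHull_min (mixedSet_subset_liftedProjection hn hQ hP) convex_liftedProjection).antisymm
    (liftedProjection_subset_convexHull hn hQ hP)

/-! ### Closedness -/

theorem LiftedSystem.r_le_one {x z : Fin n → ℝ} {x0 : ℝ} {r w s : Arc Q P → ℝ}
    (h : LiftedSystem Q P x z x0 r w s) (a : Arc Q P) : r a ≤ 1 := by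
  classical
  rw [← h.first_layer, ← h.flow.layer_eq a.layer a.layer.2]
  exact Finset.single_le_sum (fun a' _ => h.nonneg a') (by simp)

theorem LiftedSystem.s_le {x z : Fin n → ℝ} {x0 : ℝ} {r w s : Arc Q P → ℝ}
    (h : LiftedSystem Q P x z x0 r w s) (a : Arc Q P) : s a ≤ x0 :=
  (Finset.single_le_sum (fun a' _ => h.nonneg' a') (Finset.mem_univ a)).trans h.obj

theorem isClosed_setOf_liftedSystem :
    IsClosed {y : ((Fin n → ℝ) × (Fin n → ℝ) × ℝ) ×
        ((Arc Q P → ℝ) × (Arc Q P → ℝ) × (Arc Q P → ℝ)) |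
      LiftedSystem Q P y.1.1 y.1.2.1 y.1.2.2 y.2.1 y.2.2.1 y.2.2.2} := by
  classical
  have hset : {y : ((Fin n → ℝ) × (Fin n → ℝ) × ℝ) ×
        ((Arc Q P → ℝ) × (Arc Q P → ℝ) × (Arc Q P → ℝ)) |
      LiftedSystem Q P y.1.1 y.1.2.1 y.1.2.2 y.2.1 y.2.2.1 y.2.2.2} =
      {y | ∑ a, y.2.2.2 a ≤ y.1.2.2} ∩ {y | y.1.1 = ∑ a, y.2.2.1 a • a.vec} ∩
      {y | y.1.2.1 = ∑ a with a.value = true, y.2.1 a • (Pi.single a.layer 1 : Fin n → ℝ)} ∩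
      {y | ∀ v : Node Q P, v.layer ≠ 0 → v.layer ≠ Fin.last n →
        ∑ a with a.head = v, y.2.1 a = ∑ a with a.tail = v, y.2.1 a} ∩
      {y | ∑ a with (a.layer : ℕ) = 0, y.2.1 a = 1} ∩
      {y | ∑ a with (a.layer : ℕ) + 1 = n, y.2.1 a = 1} ∩
      {y | ∀ a, 0 ≤ y.2.1 a} ∩ {y | ∀ a, 0 ≤ y.2.2.2 a} ∩
      {y | ∀ a, y.2.2.1 a ^ 2 ≤ y.2.1 a * y.2.2.2 a} := by
    ext y
    constructor
    · intro h
      refine ⟨⟨⟨⟨⟨⟨⟨⟨h.obj, h.continuous_part⟩, ?_⟩, ?_⟩, h.first_layer⟩, h.last_layer⟩,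
        h.nonneg⟩, h.nonneg'⟩, h.cone⟩
      · exact h.assignment
      · intro v h0 hl
        convert h.flow v h0 hl
    · rintro ⟨⟨⟨⟨⟨⟨⟨⟨h1, h2⟩, h3⟩, h4⟩, h5⟩, h6⟩, h7⟩, h8⟩, h9⟩
      refine ⟨h1, h2, h3, ?_, h5, h6, h7, h8, h9⟩
      intro v h0 hl
      convert h4 v h0 hl
  rw [hset]
  refine ((((((((IsClosed.inter ?_ ?_).inter ?_).inter ?_).inter ?_).inter ?_).inter ?_).inter
    ?_).inter ?_)
  · exact isClosed_le (by fun_prop) (by fun_prop)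
  · exact isClosed_eq (by fun_prop) (by fun_prop)
  · exact isClosed_eq (by fun_prop) (by fun_prop)
  · simp only [Set.ofPred_forall]
    exact isClosed_iInter fun v => isClosed_iInter fun _ => isClosed_iInter fun _ =>
      isClosed_eq (by fun_prop) (by fun_prop)
  · exact isClosed_eq (by fun_prop) (by fun_prop)
  · exact isClosed_eq (by fun_prop) (by fun_prop)
  · simp only [Set.ofPred_forall]
    exact isClosed_iInter fun a => isClosed_le (by fun_prop) (by fun_prop)
  · simp only [Set.ofPred_forall]
    exact isClosed_iInter fun a => isClosed_le (by fun_prop) (by fun_prop)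
  · simp only [Set.ofPred_forall]
    exact isClosed_iInter fun a => isClosed_le (by fun_prop) (by fun_prop)

/-- As `x₀` stays bounded, so do the arc variables: `0 ≤ r ≤ 1`, `0 ≤ s ≤ x₀` and `w² ≤ r s`.
Hence the projection onto `(x, z, x₀)` is closed. -/
theorem isClosed_liftedProjection : IsClosed (liftedProjection Q P) := by
  refine IsSeqClosed.isClosed fun y p hy hyp => ?_
  choose r w s hL using hy
  have hx0 : Filter.Tendsto (fun k => (y k).2.2) Filter.atTop (nhds p.2.2) :=
    ((continuous_snd.comp continuous_snd).tendsto p).comp hyp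
  obtain ⟨M, hM⟩ := hx0.bddAbove_range
  have hM' : ∀ k, (y k).2.2 ≤ M := fun k => hM ⟨k, rfl⟩
  have hbox : IsCompact (Set.Icc
      ((fun _ => 0, fun _ => -(M + 1), fun _ => 0) :
        (Arc Q P → ℝ) × (Arc Q P → ℝ) × (Arc Q P → ℝ))
      (fun _ => 1, fun _ => M + 1, fun _ => M)) := isCompact_Icc
  have hmem : ∀ k, (r k, w k, s k) ∈ Set.Icc
      ((fun _ => 0, fun _ => -(M + 1), fun _ => 0) :
        (Arc Q P → ℝ) × (Arc Q P → ℝ) × (Arc Q P → ℝ))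
      (fun _ => 1, fun _ => M + 1, fun _ => M) := by
    intro k
    have hw : ∀ a, |w k a| ≤ M + 1 := fun a => by
      have hs0 := (hL k).nonneg' a
      have hsM := ((hL k).s_le a).trans (hM' k)
      have hrs : r k a * s k a ≤ 1 * M :=
        mul_le_mul ((hL k).r_le_one a) hsM hs0 zero_le_one
      refine abs_le_of_sq_le_sq ?_ (by linarith)
      nlinarith [(hL k).cone a]
    exact ⟨⟨(hL k).nonneg, fun a => (abs_le.1 (hw a)).1, (hL k).nonneg'⟩,
      ⟨(hL k).r_le_one, fun a => (abs_le.1 (hw a)).2,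
        fun a => ((hL k).s_le a).trans (hM' k)⟩⟩
  obtain ⟨q, -, φ, hφ, hq⟩ := hbox.tendsto_subseq hmem
  exact ⟨q.1, q.2.1, q.2.2, isClosed_setOf_liftedSystem.mem_of_tendsto
    ((hyp.comp hφ.tendsto_atTop).prodMk_nhds hq)
    (Filter.Eventually.of_forall fun k => hL (φ k))⟩

/-! ### Second-order cone representation -/

/-- A second-order cone program with two-dimensional cones given by families over finite types. -/
theorem exists_socp {ι E I K : Type*} [Fintype ι] [Fintype E] [Fintype I] [Fintype K]
    (e : E → AffineForm ι) (f : I → AffineForm ι) (g h t : K → AffineForm ι) :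
    ∃ F : SOCP ι, (∀ y, F.Feasible y ↔ (∀ k, (e k).eval y = 0) ∧ (∀ k, 0 ≤ (f k).eval y) ∧
        ∀ k, Real.sqrt ((g k).eval y ^ 2 + (h k).eval y ^ 2) ≤ (t k).eval y) ∧
      F.size = Fintype.card E + Fintype.card I + 3 * Fintype.card K := by
  let F : SOCP ι :=
    { numEq := Fintype.card E
      eq := fun k => e ((Fintype.equivFin E).symm k)
      numIneq := Fintype.card I
      ineq := fun k => f ((Fintype.equivFin I).symm k)
      numCone := Fintype.card K
      coneDim := fun _ => 2
      coneVec := fun k => ![g ((Fintype.equivFin K).symm k), h ((Fintype.equivFin K).symm k)]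
      coneTop := fun k => t ((Fintype.equivFin K).symm k) }
  refine ⟨F, fun y => ?_, ?_⟩
  · constructor
    · intro hF
      refine ⟨fun k => ?_, fun k => ?_, fun k => ?_⟩
      · simpa [F] using hF.eq (Fintype.equivFin E k)
      · simpa [F] using hF.ineq (Fintype.equivFin I k)
      · have := hF.cone (Fintype.equivFin K k)
        change Real.sqrt (∑ i : Fin 2, _) ≤ _ at this
        simpa [F, Fin.sum_univ_two] using this
    · rintro ⟨h1, h2, h3⟩
      refine ⟨fun k => h1 _, fun k => h2 _, fun k => ?_⟩
      change Real.sqrt (∑ i : Fin 2, _) ≤ _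
      simpa [F, Fin.sum_univ_two] using h3 ((Fintype.equivFin K).symm k)
  · simp [F, SOCP.size, mul_comm]

/-- The affine form in the variables `(x, z, x₀, r, w, s)` with the given coefficients. -/
def hullForm (cx cz : Fin n → ℝ) (c0 : ℝ) (cr cw cs : Arc Q P → ℝ) (k : ℝ) :
    AffineForm (HullVar Q P) :=
  ⟨hullPoint cx cz c0 cr cw cs, k⟩

theorem hullForm_eval (cx cz : Fin n → ℝ) (c0 : ℝ) (cr cw cs : Arc Q P → ℝ) (k : ℝ)
    (x z : Fin n → ℝ) (x0 : ℝ) (r w s : Arc Q P → ℝ) :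
    (hullForm cx cz c0 cr cw cs k).eval (hullPoint x z x0 r w s) =
      (∑ i, cx i * x i) + (∑ i, cz i * z i) + c0 * x0 + (∑ a, cr a * r a) + (∑ a, cw a * w a)
        + (∑ a, cs a * s a) + k := by
  simp only [AffineForm.eval, hullForm, hullPoint, Fintype.sum_sum_type, Sum.elim_inl,
    Sum.elim_inr, Finset.univ_unique, Finset.sum_singleton]
  ring

/-- The rotated cone `w² ≤ r s` as a second-order cone; the constraint forces the signs of `r` and
`s`, so no separate rows are needed for them. -/
theorem sqrt_cone_iff {r w s : ℝ} :
    Real.sqrt ((2 * w) ^ 2 + (r - s) ^ 2) ≤ r + s ↔ 0 ≤ r ∧ 0 ≤ s ∧ w ^ 2 ≤ r * s := by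
  constructor
  · intro h
    have h0 : 0 ≤ r + s := (Real.sqrt_nonneg _).trans h
    have h1 := (Real.sqrt_le_left h0).1 h
    have h2 : |r - s| ≤ r + s := abs_le_of_sq_le_sq (by nlinarith [sq_nonneg w]) h0
    have h3 := abs_le.1 h2
    exact ⟨by linarith, by linarith, by nlinarith⟩
  · rintro ⟨hr, hs, h⟩
    exact (Real.sqrt_le_left (add_nonneg hr hs)).2 (by nlinarith)

/-- The nodes that are neither in the first nor in the last layer. -/
abbrev InnerNode (Q : Matrix (Fin n) (Fin n) ℝ) (P : DynProg n S) :=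
  {v : Node Q P // v.layer ≠ 0 ∧ v.layer ≠ Fin.last n}

noncomputable instance fintypeInnerNode : Fintype (InnerNode Q P) := Fintype.ofFinite _

theorem Node.exists_arc_head (v : Node Q P) (hv : v.layer ≠ 0) : ∃ a : Arc Q P, a.head = v := by
  obtain ⟨l, M, t, h⟩ := v
  cases h with
  | root => exact absurd rfl hv
  | step l W s b t h hs =>
    exact ⟨⟨l, ⟨_, W, s, h⟩, b, ⟨_, _, _, Reachable.step l W s b _ h hs⟩, rfl, rfl, hs, rfl⟩, rfl⟩

/-- Distinct nodes beyond the first layer are heads of distinct arcs. -/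
theorem card_innerNode_le : Fintype.card (InnerNode Q P) ≤ Fintype.card (Arc Q P) := by
  choose f hf using fun v : InnerNode Q P => v.1.exists_arc_head v.2.1
  refine Fintype.card_le_of_injective f fun v v' h => Subtype.ext ?_
  rw [← hf v, h, hf v']

/-- An accepted point has a path, which uses one arc in each of the `n` layers. -/
theorem le_card_arc {Z : Set (Fin n → ℝ)} (hP : P.Represents Z) (hZ : Z.Nonempty) :
    n ≤ Fintype.card (Arc Q P) := by
  obtain ⟨z, hz⟩ := hZ
  rw [hP] at hz
  obtain ⟨b, hb, -⟩ := hz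
  obtain ⟨p, hp, -⟩ := exists_path_of_accepts (Q := Q) hb
  have := Fintype.card_le_of_injective p fun i j h => by rw [← hp.layer i, h, hp.layer]
  simpa using this

open Classical in
/-- The rows of the affine equations, in the order: definition of `x`, definition of `z`, flow
conservation, first layer, last layer. -/
noncomputable def hullEq :
    (Fin n ⊕ Fin n) ⊕ InnerNode Q P ⊕ Unit ⊕ Unit → AffineForm (HullVar Q P)
  | .inl (.inl i) => hullForm (Pi.single i 1) 0 0 0 (fun a => -a.vec i) 0 0
  | .inl (.inr i) => hullForm 0 (Pi.single i 1) 0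
      (fun a => if a.value = true then -(Pi.single a.layer 1 : Fin n → ℝ) i else 0) 0 0 0
  | .inr (.inl v) => hullForm 0 0 0
      (fun a => (if a.head = v.1 then 1 else 0) - (if a.tail = v.1 then 1 else 0)) 0 0 0
  | .inr (.inr (.inl _)) => hullForm 0 0 0 (fun a => if (a.layer : ℕ) = 0 then 1 else 0) 0 0 (-1)
  | .inr (.inr (.inr _)) =>
      hullForm 0 0 0 (fun a => if (a.layer : ℕ) + 1 = n then 1 else 0) 0 0 (-1)

theorem sum_single_mul {ι : Type*} [Fintype ι] [DecidableEq ι] (i : ι) (c : ℝ) (y : ι → ℝ) :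
    ∑ j, (Pi.single i c : ι → ℝ) j * y j = c * y i := by
  rw [Finset.sum_eq_single i] <;> simp +contextual

open Classical in
theorem liftedSystem_iff {x z : Fin n → ℝ} {x0 : ℝ} {r w s : Arc Q P → ℝ} :
    LiftedSystem Q P x z x0 r w s ↔
      (∀ k, (hullEq k).eval (hullPoint x z x0 r w s) = 0) ∧
      (∀ _ : Unit, 0 ≤ (hullForm 0 0 1 0 0 (fun _ => -1) 0).eval (hullPoint x z x0 r w s)) ∧
      ∀ a, Real.sqrt
        ((hullForm 0 0 0 0 (Pi.single a 2) 0 0).eval (hullPoint x z x0 r w s) ^ 2 +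
          (hullForm 0 0 0 (Pi.single a 1) 0 (Pi.single a (-1)) 0).eval
            (hullPoint x z x0 r w s) ^ 2) ≤
        (hullForm 0 0 0 (Pi.single a 1) 0 (Pi.single a 1) 0).eval (hullPoint x z x0 r w s) := by
  have hcone : ∀ a : Arc Q P, (Real.sqrt
        ((hullForm 0 0 0 0 (Pi.single a 2) 0 0).eval (hullPoint x z x0 r w s) ^ 2 +
          (hullForm 0 0 0 (Pi.single a 1) 0 (Pi.single a (-1)) 0).eval
            (hullPoint x z x0 r w s) ^ 2) ≤
        (hullForm 0 0 0 (Pi.single a 1) 0 (Pi.single a 1) 0).eval (hullPoint x z x0 r w s)) ↔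
      0 ≤ r a ∧ 0 ≤ s a ∧ w a ^ 2 ≤ r a * s a := by
    intro a
    rw [← sqrt_cone_iff]
    simp [hullForm_eval, sum_single_mul, sub_eq_add_neg]
  have hobj : (0 ≤ (hullForm 0 0 1 0 0 (fun _ : Arc Q P => -1) 0).eval
      (hullPoint x z x0 r w s)) ↔ ∑ a, s a ≤ x0 := by
    simp [hullForm_eval]
  have hx : (∀ i, (hullEq (.inl (.inl i))).eval (hullPoint x z x0 r w s) = 0) ↔
      x = ∑ a, w a • a.vec := by
    simp only [funext_iff, Finset.sum_apply, Pi.smul_apply, smul_eq_mul]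
    refine forall_congr' fun i => ?_
    simp [hullEq, hullForm_eval, sum_single_mul, ← sub_eq_add_neg, sub_eq_zero, mul_comm (w _)]
  have hz : (∀ i, (hullEq (.inl (.inr i))).eval (hullPoint x z x0 r w s) = 0) ↔
      z = ∑ a with a.value = true, r a • (Pi.single a.layer 1 : Fin n → ℝ) := by
    simp only [funext_iff, Finset.sum_apply, Pi.smul_apply, smul_eq_mul]
    refine forall_congr' fun i => ?_
    rw [Finset.sum_filter]
    simp only [hullEq, hullForm_eval, sum_single_mul, Pi.zero_apply, zero_mul, Finset.sum_const_zero,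
      one_mul, add_zero, zero_add, ite_mul, neg_mul]
    rw [add_eq_zero_iff_eq_neg, ← Finset.sum_neg_distrib]
    refine Eq.congr_right (Finset.sum_congr rfl fun a _ => ?_)
    split_ifs <;> simp [mul_comm]
  have hv : (∀ v, (hullEq (.inr (.inl v))).eval (hullPoint x z x0 r w s) = 0) ↔ IsFlow r := by
    have hrow : ∀ v : InnerNode Q P,
        (hullEq (.inr (.inl v))).eval (hullPoint x z x0 r w s) = 0 ↔
          ∑ a with a.head = v.1, r a = ∑ a with a.tail = v.1, r a := fun v => by
      simp [hullEq, hullForm_eval, sub_mul, Finset.sum_sub_distrib, sub_eq_zero,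
        Finset.sum_filter]
    exact ⟨fun h v h0 hl => (hrow ⟨v, h0, hl⟩).1 (h _), fun h v => (hrow v).2 (h v v.2.1 v.2.2)⟩
  have hfirst : (hullEq (.inr (.inr (.inl ())))).eval (hullPoint x z x0 r w s) = 0 ↔
      ∑ a with (a.layer : ℕ) = 0, r a = 1 := by
    simp [hullEq, hullForm_eval, ← sub_eq_add_neg, sub_eq_zero, Finset.sum_filter]
  have hlast : (hullEq (.inr (.inr (.inr ())))).eval (hullPoint x z x0 r w s) = 0 ↔
      ∑ a with (a.layer : ℕ) + 1 = n, r a = 1 := by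
    simp [hullEq, hullForm_eval, ← sub_eq_add_neg, sub_eq_zero, Finset.sum_filter]
  constructor
  · intro h
    refine ⟨?_, fun _ => hobj.2 h.obj,
      fun a => (hcone a).2 ⟨h.nonneg a, h.nonneg' a, h.cone a⟩⟩
    rintro ((i | i) | v | _ | _)
    exacts [hx.2 h.continuous_part i, hz.2 h.assignment i, hv.2 h.flow v, hfirst.2 h.first_layer,
      hlast.2 h.last_layer]
  · rintro ⟨h1, h2, h3⟩
    exact ⟨hobj.1 (h2 ()), hx.1 fun i => h1 _, hz.1 fun i => h1 _, hv.1 fun v => h1 _,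
      hfirst.1 (h1 _), hlast.1 (h1 _), fun a => ((hcone a).1 (h3 a)).1,
      fun a => ((hcone a).1 (h3 a)).2.1, fun a => ((hcone a).1 (h3 a)).2.2⟩

/-- The cones take `3|A|` rows, the equations `2n + 2` and at most `|A|` for flow conservation, and
the objective one. If `Z ≠ ∅` then `1 ≤ n ≤ |A|`. -/
theorem exists_socp_hullSystem (hn : 0 < n) {Z : Set (Fin n → ℝ)} (hP : P.Represents Z) :
    ∃ F : SOCP (HullVar Q P),
      (∀ (x z : Fin n → ℝ) (x0 : ℝ) (r w : Arc Q P → ℝ),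
        HullSystem Q P x z x0 r w ↔
          ∃ s : Arc Q P → ℝ, F.Feasible (hullPoint x z x0 r w s)) ∧
      F.size ≤ 4 * Fintype.card (Arc Q P) + 2 * n + 3 ∧
      (Z.Nonempty → F.size ≤ 9 * Fintype.card (Arc Q P)) := by
  classical
  obtain ⟨F, hF, hsize⟩ := exists_socp (hullEq (Q := Q) (P := P))
    (fun _ : Unit => hullForm 0 0 1 0 0 (fun _ => -1) 0)
    (fun a => hullForm 0 0 0 0 (Pi.single a 2) 0 0)
    (fun a => hullForm 0 0 0 (Pi.single a 1) 0 (Pi.single a (-1)) 0)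
    (fun a => hullForm 0 0 0 (Pi.single a 1) 0 (Pi.single a 1) 0)
  have hnode := card_innerNode_le (Q := Q) (P := P)
  have hbound : F.size ≤ 4 * Fintype.card (Arc Q P) + 2 * n + 3 := by
    rw [hsize]
    simp only [Fintype.card_sum, Fintype.card_fin, Fintype.card_unit]
    omega
  refine ⟨F, fun x z x0 r w => ?_, hbound, fun hZ => ?_⟩
  · rw [hullSystem_iff_exists_lifted]
    exact exists_congr fun s => by
      rw [hF, liftedSystem_iff]
  · have := le_card_arc (Q := Q) hP hZ
    omega

end

end MIQO

theorem mainTheorem2 {n : ℕ} (hn : 0 < n) {S : Type*}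
    (Q : Matrix (Fin n) (Fin n) ℝ) (hQ : Q.PosDef)
    (Z : Set (Fin n → ℝ)) (P : MIQO.DynProg n S) (hP : P.Represents Z) :
    (∀ (x z : Fin n → ℝ) (x0 : ℝ),
      (x, z, x0) ∈ convexHull ℝ (MIQO.mixedSet Q Z) ↔
        ∃ r w : MIQO.Arc Q P → ℝ, MIQO.HullSystem Q P x z x0 r w) ∧
    IsClosed (convexHull ℝ (MIQO.mixedSet Q Z)) ∧
    ∃ F : MIQO.SOCP (MIQO.HullVar Q P),
      (∀ (x z : Fin n → ℝ) (x0 : ℝ) (r w : MIQO.Arc Q P → ℝ),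
        MIQO.HullSystem Q P x z x0 r w ↔
          ∃ s : MIQO.Arc Q P → ℝ, F.Feasible (MIQO.hullPoint x z x0 r w s)) ∧
      F.size ≤ 4 * Fintype.card (MIQO.Arc Q P) + 2 * n + 3 ∧
      (Z.Nonempty → F.size ≤ 9 * Fintype.card (MIQO.Arc Q P)) := by
  rw [MIQO.convexHull_mixedSet_eq hn hQ hP]
  refine ⟨fun x z x0 => ?_, MIQO.isClosed_liftedProjection, MIQO.exists_socp_hullSystem hn hP⟩
  simp only [MIQO.hullSystem_iff_exists_lifted]
  rfl
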